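/- A surface is a Hausdorff space (not assumed connected or metrisable) in which every point has a neighbourhood homeomorphic to $\mathbb{R}\times\mathbb{R}_{\ge 0}$; its boundary $\partial M$ is the set of points that have no neighbourhood homeomorphic to $\mathbb{R}^2$, and $M-\partial M$ is its interior. A closed subset $B$ of a space $X$ is collared in $X$ if there is an embedding $h:B\times[0,1]\to X$ with $h(x,0)=x$ for $x\in B$, $h^{-1}(B)=B\times\{0\}$ and $h(B\times[0,1))$ open in $X$. The closed long ray $\mathbb{L}_{\ge 0}$ is $\omega_1\times[0,1)$ with the topology of the lexicographic order, $\alpha\in\omega_1$ being identified with $\langle\alpha,0\rangle$, and $\mathbb{L}_+$ is $\mathbb{L}_{\ge 0}$ minus its least point. For $a\in\mathbb{R}$ and a linearly ordered set $I$, a family of curves pointing at $\langle 0,a\rangle$ indexed by $I$ is a family $(c_i)_{i\in I}$ of continuous functions $c_i:(0,\infty)\to\mathbb{R}$ such that $c_i(t)\to a$ as $t\to 0^+$ for every $i$ and such that, whenever $i<j$, one has $c_i(t)<c_j(t)$ for all sufficiently small $t>0$. Given such a family $c$ indexed by $\mathbb{L}_+$, the Nyikosisation $N(c)$ of the half-plane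 at $\langle 0,a\rangle$ is the disjoint union of $(0,\infty)\times\mathbb{R}$ and $\mathbb{L}_+$ (all of the original boundary $\{0\}\times\mathbb{R}$ is removed), in which $(0,\infty)\times\mathbb{R}$ is open with its usual topology and the basic neighbourhoods of $x\in\mathbb{L}_+$ are the sets $$(u,v)\cup\{\langle t,y\rangle : 0<t<w,\ c_u(t)<y<c_v(t)\},\qquad u<x<v \text{ in } \mathbb{L}_+,\ w>0.$$ **Example (Nyikos).** Let $a\in\mathbb{R}$. Families of curves pointing at $\langle 0,a\rangle$ indexed by $\omega_1$ exist, and each of them extends to a family indexed by $\mathbb{L}_+$ (that is, there is a family indexed by $\mathbb{L}_+$ whose curve of index $\alpha$ is the given one for every $0<\alpha<\omega_1$). For every family $c$ of curves pointing at $\langle 0,a\rangle$ indexed by $\mathbb{L}_+$, the space $N(c)$ is a surface with metrisable interior; its boundary is the added set $\mathbb{L}_+$, on which $N(c)$ induces the topology of the long ray, so that the boundary is connected (there is a single boundary component); and this boundary is not collared in $N(c)$. -/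

import Mathlib

open Set Filter Topology
open scoped NNReal unitInterval

noncomputable section

/-! ### Surfaces with boundary and collars -/

/-- A surface: a Hausdorff space in which every point has a neighbourhood homeomorphic to the
closed half-plane. Neither connectedness nor metrisability is required. -/
def IsSurface (X : Type*) [TopologicalSpace X] : Prop :=
  T2Space X ∧ ∀ x : X, ∃ U ∈ 𝓝 x, Nonempty (U ≃ₜ ℝ × ℝ≥0)

/-- The manifold boundary of a surface: the points that have no neighbourhood homeomorphic to
the plane. -/
def surfaceBoundary (X : Type*) [TopologicalSpace X] : Set X :=
  {x | ¬ ∃ U ∈ 𝓝 x, Nonempty (U ≃ₜ ℝ × ℝ)}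

/-- A (closed) subset `B` of `X` is collared: there is an embedding `h : B × [0,1] → X` with
`h (x, 0) = x`, with `h ⁻¹ B = B × {0}`, and such that the image of `B × [0,1)` is open. -/
def IsCollared {X : Type*} [TopologicalSpace X] (B : Set X) : Prop :=
  ∃ h : B × I → X, IsEmbedding h ∧ (∀ x : B, h (x, 0) = x) ∧
    h ⁻¹' B = {p | p.2 = 0} ∧ IsOpen (h '' {p | p.2 < 1})

/-! ### The long ray -/

/-- The first uncountable ordinal, as an ordered set. -/
abbrev OmegaOne : Type := (Ordinal.omega.{0} 1).ToType

/-- The closed long ray `ω₁ × [0,1)`, ordered lexicographically. -/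
def ClosedLongRay : Type := OmegaOne ×ₗ (Ico (0 : ℝ) 1)

instance : LinearOrder ClosedLongRay :=
  inferInstanceAs (LinearOrder (OmegaOne ×ₗ (Ico (0 : ℝ) 1)))

instance : TopologicalSpace ClosedLongRay := Preorder.topology ClosedLongRay

instance : OrderTopology ClosedLongRay := ⟨rfl⟩

/-- The ordinal `α` viewed as the point `(α, 0)` of the closed long ray. -/
def ClosedLongRay.ofOmegaOne (α : OmegaOne) : ClosedLongRay :=
  toLex (α, ⟨0, by simp⟩)

/-- The open long ray: the closed long ray without its least point. -/
def LongRay : Type := {x : ClosedLongRay // ¬ IsMin x}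

instance : LinearOrder LongRay :=
  inferInstanceAs (LinearOrder {x : ClosedLongRay // ¬ IsMin x})

instance : TopologicalSpace LongRay :=
  inferInstanceAs (TopologicalSpace {x : ClosedLongRay // ¬ IsMin x})

instance : DenselyOrdered ClosedLongRay :=
  inferInstanceAs (DenselyOrdered (OmegaOne ×ₗ (Ico (0 : ℝ) 1)))

instance : NoMaxOrder ClosedLongRay :=
  inferInstanceAs (NoMaxOrder (OmegaOne ×ₗ (Ico (0 : ℝ) 1)))

instance : NoMinOrder LongRay where
  exists_lt x := by
    obtain ⟨z, hz⟩ := not_isMin_iff.1 x.2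
    obtain ⟨y, hzy, hyx⟩ := exists_between hz
    exact ⟨⟨y, not_isMin_of_lt hzy⟩, hyx⟩

instance : NoMaxOrder LongRay where
  exists_gt x := by
    obtain ⟨y, hxy⟩ := exists_gt x.1
    exact ⟨⟨y, not_isMin_of_lt hxy⟩, hxy⟩

/-! ### Nyikosisation -/

/-- A family of curves in the half-plane pointing at `(0, a)`, indexed by an ordered set `ι`: the
curve with index `i` is the graph of a continuous function on `(0, ∞)` with limit `a` at `0`,
and, if `i < j`, close enough to the vertical axis the curve `j` is above the curve `i`.
(Values of `curve i` outside `(0, ∞)` are irrelevant.) -/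
structure CurveFamily (ι : Type*) [LT ι] (a : ℝ) where
  curve : ι → ℝ → ℝ
  continuousOn_curve : ∀ i, ContinuousOn (curve i) (Ioi 0)
  tendsto_curve : ∀ i, Tendsto (curve i) (𝓝[>] 0) (𝓝 a)
  eventually_lt : ∀ i j, i < j → ∀ᶠ t in 𝓝[>] (0 : ℝ), curve i t < curve j t

/-- The open half-plane `(0, ∞) × ℝ`. -/
abbrev OpenHalfPlane : Type := {p : ℝ × ℝ // 0 < p.1}

/-- The points of the Nyikosisation of the half-plane along a family of curves indexed by the
open long ray: the points of the open half-plane, and the points of the added long ray. -/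
inductive Nyikosisation {a : ℝ} (c : CurveFamily LongRay a) : Type
  | plane (p : OpenHalfPlane) : Nyikosisation c
  | ray (x : LongRay) : Nyikosisation c

namespace Nyikosisation

variable {a : ℝ} (c : CurveFamily LongRay a)

/-- The part of the half-plane strictly between the curves `u` and `v` and to the left of the
vertical line `{w} × ℝ`. -/
def sector (u v : LongRay) (w : ℝ) : Set OpenHalfPlane :=
  {p | p.1.1 < w ∧ c.curve u p.1.1 < p.1.2 ∧ p.1.2 < c.curve v p.1.1}

/-- The basic neighbourhoods of the points of the interval `(u, v)` of the long ray: the union of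
this interval and of the sector given by `u`, `v` and `w`. -/
def basicNhd (u v : LongRay) (w : ℝ) : Set (Nyikosisation c) :=
  plane '' sector c u v w ∪ ray '' Ioo u v

variable {c} in
theorem basicNhd_subset_of_le {u v u' v' : LongRay} {w : ℝ} (hw : 0 < w)
    (hu : u ≤ u') (hv : v' ≤ v) :
    ∃ w', 0 < w' ∧ basicNhd c u' v' w' ⊆ basicNhd c u v w := by
  have key : ∀ i j : LongRay, i ≤ j → ∀ᶠ t in 𝓝[>] (0 : ℝ), c.curve i t ≤ c.curve j t := by
    intro i j hij
    rcases hij.eq_or_lt with rfl | h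
    · exact Eventually.of_forall fun _ => le_rfl
    · exact (c.eventually_lt i j h).mono fun _ => le_of_lt
  obtain ⟨e, he, hE⟩ := mem_nhdsGT_iff_exists_Ioo_subset.1 ((key u u' hu).and (key v' v hv))
  refine ⟨min w e, lt_min hw he, ?_⟩
  rintro _ (⟨p, ⟨h1, h2, h3⟩, rfl⟩ | ⟨x, hx, rfl⟩)
  · have := hE (show p.1.1 ∈ Ioo 0 e from ⟨p.2, h1.trans_le (min_le_right _ _)⟩)
    exact Or.inl ⟨p, ⟨h1.trans_le (min_le_left _ _), this.1.trans_lt h2,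
      h3.trans_le this.2⟩, rfl⟩
  · exact Or.inr ⟨x, ⟨hu.trans_lt hx.1, hx.2.trans_le hv⟩, rfl⟩

variable {c} in
theorem basicNhd_subset_of_le_right {u v : LongRay} {w w' : ℝ} (h : w' ≤ w) :
    basicNhd c u v w' ⊆ basicNhd c u v w := by
  rintro _ (⟨p, ⟨h1, h2⟩, rfl⟩ | ⟨x, hx, rfl⟩)
  · exact Or.inl ⟨p, ⟨h1.trans_le h, h2⟩, rfl⟩
  · exact Or.inr ⟨x, hx, rfl⟩

/-- A set is open if its trace on the half-plane is open and if it contains, with each point `x`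
of the long ray, a basic neighbourhood given by some interval `(u, v)` that contains `x`. -/
instance : TopologicalSpace (Nyikosisation c) where
  IsOpen S := IsOpen (plane ⁻¹' S : Set OpenHalfPlane) ∧
    ∀ x, ray x ∈ S → ∃ u v w, u < x ∧ x < v ∧ 0 < w ∧ basicNhd c u v w ⊆ S
  isOpen_univ := by
    refine ⟨isOpen_univ, fun x _ => ?_⟩
    obtain ⟨u, hu⟩ := exists_lt x
    obtain ⟨v, hv⟩ := exists_gt x
    exact ⟨u, v, 1, hu, hv, one_pos, subset_univ _⟩
  isOpen_inter S T hS hT := by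
    refine ⟨hS.1.inter hT.1, fun x hx => ?_⟩
    obtain ⟨u₁, v₁, w₁, hu₁, hv₁, hw₁, h₁⟩ := hS.2 x hx.1
    obtain ⟨u₂, v₂, w₂, hu₂, hv₂, hw₂, h₂⟩ := hT.2 x hx.2
    obtain ⟨e₁, he₁, hE₁⟩ := basicNhd_subset_of_le (c := c) hw₁ (le_max_left u₁ u₂)
      (min_le_left v₁ v₂)
    obtain ⟨e₂, he₂, hE₂⟩ := basicNhd_subset_of_le (c := c) hw₂ (le_max_right u₁ u₂)
      (min_le_right v₁ v₂)
    exact ⟨max u₁ u₂, min v₁ v₂, min e₁ e₂, max_lt hu₁ hu₂, lt_min hv₁ hv₂, lt_min he₁ he₂,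
      subset_inter
        ((basicNhd_subset_of_le_right (min_le_left _ _)).trans (hE₁.trans h₁))
        ((basicNhd_subset_of_le_right (min_le_right _ _)).trans (hE₂.trans h₂))⟩
  isOpen_sUnion := by
    intro 𝒮 h𝒮
    refine ⟨?_, ?_⟩
    · rw [preimage_sUnion]
      exact isOpen_biUnion fun S hS => (h𝒮 S hS).1
    · rintro x ⟨S, hS, hx⟩
      obtain ⟨u, v, w, hu, hv, hw, h⟩ := (h𝒮 S hS).2 x hx
      exact ⟨u, v, w, hu, hv, hw, h.trans (subset_sUnion_of_mem hS)⟩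

end Nyikosisation

end

/-! ### Countability properties of the first uncountable ordinal -/

/-! Families indexed by ω₁ come from transfinite recursion: an initial segment is countable, and
countably many curves lie below a single one near the axis (`exists_dominating_curve`).
Interpolating affinely between the curves of index α and α + 1 extends a family to the long ray.

The main difficulty is a chart at an added point x. The interval [u, v] around x is a copy of [0,
1], but its uncountably many curves need not be simultaneously ordered on any strip 0 < t < w. Only
the dyadic curves are therefore followed: `exists_foliation` fills the region between `c_u` and
`c_v` with leaves varying continuously in t, each dyadic leaf agreeing with its curve for small t.
Density of the dyadic parameters suffices, since sectors bounded by such curves already form a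
neighbourhood base along the ray. Sending (s, t) to the point of abscissa t on leaf s, and (s, 0) to
the ray, then gives a chart (`exists_chart_on_box`).

The added points are boundary points by a winding argument: a punctured half-disc admits a
logarithm, whereas a circle around a point of the plane does not.

Finally, the slice at height 1 of a collar would embed the long ray in the open half-plane. The
latter is second countable, while the long ray is not separable. -/

theorem OmegaOne.countable_Iio (α : OmegaOne) : (Iio α).Countable := by
  have h : ∀ c : Cardinal.{0}, c.ord = Ordinal.omega 1 → c = Cardinal.aleph 1 →
      ∀ β : (Ordinal.omega.{0} 1).ToType, (Iio β).Countable := by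
    rintro c hc h1
    rw [← hc]
    intro β
    rw [← Cardinal.le_aleph0_iff_set_countable, ← Cardinal.lt_aleph_one_iff, ← h1]
    simpa using Cardinal.mk_Iio_lt β (by simp)
  exact h _ (Cardinal.ord_aleph 1) rfl α

instance OmegaOne.uncountable : Uncountable OmegaOne := by
  rw [← Cardinal.aleph0_lt_mk_iff, Cardinal.mk_toType, Ordinal.card_omega]
  exact Cardinal.aleph0_lt_aleph_one

instance OmegaOne.noMaxOrder : NoMaxOrder OmegaOne where
  exists_gt α := by
    by_contra! h
    have hc : (insert α (Iio α)).Countable := (OmegaOne.countable_Iio α).insert α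
    refine not_countable_univ (hc.mono fun β _ => ?_)
    exact (h β).eq_or_lt.imp id id

/-! ### Families of curves -/

/-- Countably many curves pointing at the same point are dominated near that point by a single
one. -/
theorem exists_dominating_curve {ι : Type*} [Countable ι] {a : ℝ} (f : ι → ℝ → ℝ)
    (hc : ∀ i, ContinuousOn (f i) (Ioi 0)) (ht : ∀ i, Tendsto (f i) (𝓝[>] 0) (𝓝 a)) :
    ∃ g : ℝ → ℝ, ContinuousOn g (Ioi 0) ∧ Tendsto g (𝓝[>] 0) (𝓝 a) ∧
      ∀ i, ∀ᶠ t in 𝓝[>] (0 : ℝ), f i t < g t := by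
  obtain ⟨ε, hε, b, hb, -⟩ := NNReal.exists_pos_sum_of_countable one_ne_zero ι
  have hs : Summable fun i => (ε i : ℝ) := NNReal.summable_coe.2 hb.summable
  have hle : ∀ i t, ‖min (ε i : ℝ) |f i t - a|‖ ≤ ε i := fun i t => by
    rw [Real.norm_of_nonneg (le_min (ε i).coe_nonneg (abs_nonneg (f i t - a)))]
    exact min_le_left _ _
  have hlim : ∀ i, Tendsto (fun t => |f i t - a|) (𝓝[>] 0) (𝓝 0) := fun i => by
    simpa using ((ht i).sub_const a).abs
  -- Truncating at the summable `ε i` makes the series converge uniformly. For small t the i-th term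
  -- is the full |f i t - a|, so the sum reaches `f i t - a`, and the summand t makes the inequality
  -- strict.
  refine ⟨fun t => a + t + ∑' i, min (ε i : ℝ) |f i t - a|, ?_, ?_, fun i => ?_⟩
  · refine (by fun_prop : ContinuousOn (fun t : ℝ => a + t) (Ioi 0)).add
      (continuousOn_tsum (fun i => ?_) hs fun i t _ => hle i t)
    exact continuousOn_const.inf ((hc i).sub continuousOn_const).abs
  · have h1 : Tendsto (fun t => ∑' i, min (ε i : ℝ) |f i t - a|) (𝓝[>] 0)
        (𝓝 (∑' _ : ι, (0 : ℝ))) := by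
      refine tendsto_tsum_of_dominated_convergence hs (fun i => ?_)
        (Eventually.of_forall fun t i => hle i t)
      simpa using (tendsto_const_nhds (x := (ε i : ℝ))).min (hlim i)
    have h2 : Tendsto (fun t : ℝ => a + t) (𝓝[>] 0) (𝓝 (a + 0)) :=
      ((continuous_const.add continuous_id).tendsto 0).mono_left nhdsWithin_le_nhds
    simpa using h2.add h1
  · filter_upwards [(hlim i).eventually_lt_const (NNReal.coe_pos.2 (hε i)), self_mem_nhdsWithin]
      with t h1 h2
    have h3 : min (ε i : ℝ) |f i t - a| ≤ ∑' i, min (ε i : ℝ) |f i t - a| :=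
      (Summable.of_norm_bounded hs fun i => hle i t).le_tsum i
        fun j _ => le_min (ε j).coe_nonneg (abs_nonneg _)
    rw [min_eq_right h1.le] at h3
    have h4 := le_abs_self (f i t - a)
    have h5 : (0 : ℝ) < t := h2
    linarith

theorem nonempty_curveFamily_omegaOne (a : ℝ) : Nonempty (CurveFamily OmegaOne a) := by
  let C := {f : ℝ → ℝ // ContinuousOn f (Ioi 0) ∧ Tendsto f (𝓝[>] 0) (𝓝 a)}
  have step : ∀ (α : OmegaOne) (F : ∀ β, β < α → C), ∃ g : C,
      ∀ β (h : β < α), ∀ᶠ t in 𝓝[>] (0 : ℝ), (F β h).1 t < g.1 t := fun α F => by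
    have := (OmegaOne.countable_Iio α).to_subtype
    obtain ⟨g, hg, hg', h⟩ := exists_dominating_curve (fun β : Iio α => (F β β.2).1)
      (fun β => (F β β.2).2.1) fun β => (F β β.2).2.2
    exact ⟨⟨g, hg, hg'⟩, fun β hβ => h ⟨β, hβ⟩⟩
  choose G hG using step
  let φ : OmegaOne → C := (wellFounded_lt (α := OmegaOne)).fix G
  have hφ : ∀ α, φ α = G α fun β _ => φ β := fun α => WellFounded.fix_eq _ _ _
  refine ⟨⟨fun α => (φ α).1, fun α => (φ α).2.1, fun α => (φ α).2.2, fun α β h => ?_⟩⟩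
  rw [hφ β]
  exact hG β (fun β _ => φ β) α h

namespace CurveFamily

theorem eventually_le {ι : Type*} [LinearOrder ι] {a : ℝ} (c : CurveFamily ι a) {i j : ι}
    (h : i ≤ j) : ∀ᶠ t in 𝓝[>] (0 : ℝ), c.curve i t ≤ c.curve j t := by
  rcases h.eq_or_lt with rfl | h
  · exact Eventually.of_forall fun _ => le_rfl
  · exact (c.eventually_lt i j h).mono fun _ => le_of_lt

end CurveFamily

theorem ClosedLongRay.lt_iff (x y : ClosedLongRay) :
    x < y ↔ (ofLex x).1 < (ofLex y).1 ∨
      (ofLex x).1 = (ofLex y).1 ∧ ((ofLex x).2 : ℝ) < (ofLex y).2 :=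
  Prod.Lex.lt_iff

/-- A family of curves indexed by `ω₁` extends linearly to the long ray. -/
theorem exists_curveFamily_longRay {a : ℝ} (d : CurveFamily OmegaOne a) :
    ∃ c : CurveFamily LongRay a,
      ∀ (α : OmegaOne) (hα : ¬ IsMin (ClosedLongRay.ofOmegaOne α)),
        EqOn (c.curve ⟨ClosedLongRay.ofOmegaOne α, hα⟩) (d.curve α) (Ioi 0) := by
  let e : ClosedLongRay → ℝ → ℝ := fun x t =>
    (1 - ((ofLex x).2 : ℝ)) * d.curve (ofLex x).1 t +
      (ofLex x).2 * d.curve (Order.succ (ofLex x).1) t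
  have hlt : ∀ x y : ClosedLongRay, x < y → ∀ᶠ t in 𝓝[>] (0 : ℝ), e x t < e y t := by
    intro x y hxy
    have hx := (ofLex x).2.2
    have hy := (ofLex y).2.2
    have sx := d.eventually_lt _ _ (Order.lt_succ (ofLex x).1)
    have sy := d.eventually_lt _ _ (Order.lt_succ (ofLex y).1)
    rcases (ClosedLongRay.lt_iff x y).1 hxy with h | ⟨h1, h2⟩
    -- With α < β the ordinals below x and y: `e x` < curve α + 1 ≤ curve β ≤ `e y`. The first
    -- inequality is strict because the weight of x is less than 1.
    · filter_upwards [sx, sy, d.eventually_le (Order.succ_le_of_lt h)] with t h1 h2 h3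
      simp only [e]
      nlinarith [mul_pos (sub_pos.2 hx.2) (sub_pos.2 h1), mul_nonneg hy.1 (sub_pos.2 h2).le]
    · filter_upwards [sx] with t h3
      simp only [e, ← h1]
      nlinarith [mul_pos (sub_pos.2 h2) (sub_pos.2 h3)]
  refine ⟨⟨fun x => e x.1, fun x => ?_, fun x => ?_, fun x y h => hlt x.1 y.1 h⟩, fun α hα t _ => ?_⟩
  · exact (continuousOn_const.mul (d.continuousOn_curve _)).add
      (continuousOn_const.mul (d.continuousOn_curve _))
  · have := ((d.tendsto_curve (ofLex x.1).1).const_mul (1 - ((ofLex x.1).2 : ℝ))).add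
      ((d.tendsto_curve (Order.succ (ofLex x.1).1)).const_mul ((ofLex x.1).2 : ℝ))
    convert this using 2
    ring
  · simp [e, ClosedLongRay.ofOmegaOne]

/-! ### Intervals of the long ray -/

/-- Below a given ordinal, the closed long ray maps increasingly to the real line, with an image
that is an interval. -/
theorem ClosedLongRay.exists_real_coordinate (α : OmegaOne) :
    ∃ G : ClosedLongRay → ℝ, StrictMonoOn G {x | (ofLex x).1 < α} ∧
      ∀ x y : ClosedLongRay, (ofLex y).1 < α → Icc (G x) (G y) ⊆ G '' {x | (ofLex x).1 < α} := by
  obtain ⟨w₀, hw₀, b, hb, -⟩ := (OmegaOne.countable_Iio α).exists_pos_hasSum_le one_pos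
  let w : OmegaOne → ℝ := (Iio α).indicator w₀
  have hw : ∀ β, 0 ≤ w β := fun β => indicator_nonneg (fun _ _ => (hw₀ _).le) β
  have hwpos : ∀ β < α, 0 < w β := fun β hβ => by
    simpa [w, indicator_of_mem (show β ∈ Iio α from hβ)] using hw₀ β
  have hws : Summable w := summable_subtype_iff_indicator.1 hb.summable
  -- The segment from β to β + 1 is given length `w β`, and `P β` is the total length before β.
  let P : OmegaOne → ℝ := fun β => ∑' γ, (Iio β).indicator w γ
  have hPs : ∀ s : Set OmegaOne, Summable (s.indicator w) := fun s => hws.indicator s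
  have hP0 : ∀ β, 0 ≤ P β := fun β => tsum_nonneg fun γ => indicator_nonneg (fun _ _ => hw _) γ
  have hIic : ∀ β, P β + w β = ∑' γ, (Iic β).indicator w γ := fun β => by
    have h : ∀ γ, (Iic β).indicator w γ = (Iio β).indicator w γ + ({β} : Set _).indicator w γ := by
      intro γ
      rw [← Iio_union_right, indicator_union_of_disjoint (by simp)]
    simp_rw [h]
    rw [(hPs _).tsum_add (hPs _), ← tsum_subtype {β} w, tsum_singleton]
  have hPlt : ∀ β γ, β < γ → P β + w β ≤ P γ := fun β γ h => by
    rw [hIic]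
    exact (hPs _).tsum_le_tsum
      (fun δ => indicator_le_indicator_of_subset (fun _ hx => lt_of_le_of_lt hx h) hw δ) (hPs _)
  let G : ClosedLongRay → ℝ := fun x => P (ofLex x).1 + (ofLex x).2 * w (ofLex x).1
  refine ⟨G, fun x hx y hy hxy => ?_, fun x y hy z hz => ?_⟩
  · rcases (ClosedLongRay.lt_iff x y).1 hxy with h | ⟨h1, h2⟩
    · have h1 := hPlt _ _ h
      have h2 := mul_pos (sub_pos.2 (ofLex x).2.2.2) (hwpos _ hx)
      have h3 := mul_nonneg (ofLex y).2.2.1 (hw (ofLex y).1)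
      simp only [G]
      linarith
    · have h3 := mul_pos (sub_pos.2 h2) (hwpos _ hx)
      simp only [G, ← h1]
      linarith
  · have hz0 : 0 ≤ z := le_trans
      (add_nonneg (hP0 _) (mul_nonneg (ofLex x).2.2.1 (hw (ofLex x).1))) hz.1
    let S : Set OmegaOne := {β | z < P β + w β}
    have hyS : (ofLex y).1 ∈ S := by
      have h2 := mul_pos (sub_pos.2 (ofLex y).2.2.2) (hwpos _ hy)
      have h3 := hz.2
      simp only [S, mem_ofPred_eq, G] at h3 ⊢
      linarith
    obtain ⟨β, hβS, hβ⟩ := WellFounded.has_min (wellFounded_lt (α := OmegaOne)) S ⟨_, hyS⟩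
    have hβα : β < α := (not_lt.1 (hβ _ hyS)).trans_lt hy
    -- `P` does not jump at limit ordinals: a nonempty finite set of ordinals below β has a largest
    -- element δ, so its weight is at most `P δ + w δ`, which is at most z by minimality of β.
    have hPz : P β ≤ z := by
      refine (hPs _).tsum_le_of_sum_le fun F => ?_
      rcases (F.filter (· < β)).eq_empty_or_nonempty with h | h
      · rw [Finset.sum_eq_zero]
        · exact hz0
        · intro γ hγ
          refine indicator_of_notMem (fun hγβ => ?_) _
          exact Finset.notMem_empty γ (h ▸ Finset.mem_filter.2 ⟨hγ, hγβ⟩)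
      · obtain ⟨δ, hδ, hmax⟩ := Finset.exists_max_image _ id h
        have hδz : P δ + w δ ≤ z := not_lt.1 fun h => hβ δ h (Finset.mem_filter.1 hδ).2
        rw [hIic] at hδz
        refine le_trans ?_ hδz
        refine le_trans (Finset.sum_le_sum fun γ hγ => ?_) ((hPs (Iic δ)).sum_le_tsum F
          fun γ _ => indicator_nonneg (fun _ _ => hw _) γ)
        by_cases hγβ : γ < β
        · rw [indicator_of_mem (show γ ∈ Iio β from hγβ), indicator_of_mem
            (show γ ∈ Iic δ from hmax γ (Finset.mem_filter.2 ⟨hγ, hγβ⟩))]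
        · rw [indicator_of_notMem (show γ ∉ Iio β from hγβ)]
          exact indicator_nonneg (fun _ _ => hw _) γ
    have hpos := hwpos β hβα
    refine ⟨toLex (β, ⟨(z - P β) / w β, div_nonneg (by linarith) hpos.le, ?_⟩), hβα, ?_⟩
    · rw [div_lt_one hpos]
      have : z < P β + w β := hβS
      linarith
    · simp only [G, ofLex_toLex]
      field_simp
      ring

/-- Closed intervals of the long ray are order isomorphic to the unit interval. -/
theorem LongRay.exists_parametrization {u v : LongRay} (huv : u < v) :
    ∃ τ : ℝ → LongRay, StrictMonoOn τ (Icc 0 1) ∧ τ '' Icc 0 1 = Icc u v := by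
  obtain ⟨α, hα⟩ := exists_gt (ofLex v.1).1
  obtain ⟨G, hG, hGr⟩ := ClosedLongRay.exists_real_coordinate α
  have hle : ∀ x : ClosedLongRay, x ≤ v.1 → (ofLex x).1 < α := fun x hx => by
    rcases hx.eq_or_lt with rfl | h
    · exact hα
    · rcases (ClosedLongRay.lt_iff _ _).1 h with h | h
      · exact h.trans hα
      · exact h.1 ▸ hα
  have hdom : ∀ x : ClosedLongRay, x ≤ v.1 → x ∈ {x : ClosedLongRay | (ofLex x).1 < α} := hle
  have hGuv : G u.1 < G v.1 := hG (hdom _ (le_of_lt huv)) (hdom _ le_rfl) huv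
  let f : LongRay → ℝ := fun x => (G x.1 - G u.1) / (G v.1 - G u.1)
  have hpos := sub_pos.2 hGuv
  have hf : StrictMonoOn f (Icc u v) := fun x hx y hy hxy =>
    div_lt_div_of_pos_right (sub_lt_sub_right (hG (hdom _ hx.2) (hdom _ hy.2) hxy) _) hpos
  have hf0 : f u = 0 := by simp [f]
  have hf1 : f v = 1 := div_self hpos.ne'
  have hmaps : MapsTo f (Icc u v) (Icc 0 1) := fun x hx =>
    ⟨hf0 ▸ hf.monotoneOn (left_mem_Icc.2 huv.le) hx hx.1,
      hf1 ▸ hf.monotoneOn hx (right_mem_Icc.2 huv.le) hx.2⟩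
  have hsurj : SurjOn f (Icc u v) (Icc 0 1) := by
    intro s hs
    obtain ⟨x, hxα, hx⟩ := hGr u.1 v.1 hα (show G u.1 + s * (G v.1 - G u.1) ∈ _ from
      ⟨by nlinarith [hs.1], by nlinarith [hs.2]⟩)
    have hux : u.1 ≤ x := (hG.le_iff_le (hdom _ (le_of_lt huv)) hxα).1 (by nlinarith [hs.1])
    have hxv : x ≤ v.1 := (hG.le_iff_le hxα (hdom _ le_rfl)).1 (by nlinarith [hs.2])
    refine ⟨⟨x, fun h => u.2 (h.mono hux)⟩, ⟨hux, hxv⟩, ?_⟩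
    simp only [f, hx]
    field_simp
    ring
  have hbij : BijOn f (Icc u v) (Icc 0 1) := ⟨hmaps, hf.injOn, hsurj⟩
  have : Nonempty LongRay := ⟨u⟩
  have hinv := hbij.invOn_invFunOn
  refine ⟨Function.invFunOn f (Icc u v), fun s hs t ht hst => ?_,
    (hbij.symm hinv.symm).image_eq⟩
  have hm := (hbij.symm hinv.symm).mapsTo
  rw [← hf.lt_iff_lt (hm hs) (hm ht), hinv.2 hs, hinv.2 ht]
  exact hst

instance LongRay.orderTopology : OrderTopology LongRay := by
  have : OrdConnected {x : ClosedLongRay | ¬ IsMin x} :=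
    ⟨fun x hx _ _ z hz h => hx (h.mono hz.1)⟩
  exact orderTopology_of_ordConnected (t := {x : ClosedLongRay | ¬ IsMin x})

theorem StrictMonoOn.continuousOn_of_image_Icc {α β : Type*} [LinearOrder α] [TopologicalSpace α]
    [OrderTopology α] [LinearOrder β] [TopologicalSpace β] [OrderTopology β] {f : α → β} {a b : α}
    {c d : β} (hf : StrictMonoOn f (Icc a b)) (h : f '' Icc a b = Icc c d) :
    ContinuousOn f (Icc a b) := by
  let e : Icc a b ≃o Icc c d := (hf.orderIso f _).trans (OrderIso.setCongr _ _ h)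
  rw [continuousOn_iff_continuous_domRestrict]
  exact continuous_subtype_val.comp e.continuous

theorem LongRay.isPreconnected_univ : IsPreconnected (univ : Set LongRay) := by
  refine isPreconnected_of_forall_pair fun x _ y _ => ?_
  obtain ⟨u, hu⟩ := exists_lt (min x y)
  obtain ⟨v, hv⟩ := exists_gt (max x y)
  have huv : u < v := hu.trans_le (min_le_max.trans hv.le)
  obtain ⟨τ, hτ, him⟩ := LongRay.exists_parametrization huv
  refine ⟨Icc u v, subset_univ _, ⟨?_, ?_⟩, ⟨?_, ?_⟩, ?_⟩
  · exact hu.le.trans (min_le_left _ _)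
  · exact (le_max_left _ _).trans hv.le
  · exact hu.le.trans (min_le_right _ _)
  · exact (le_max_right _ _).trans hv.le
  · rw [← him]
    exact isPreconnected_Icc.image _ (hτ.continuousOn_of_image_Icc him)

instance LongRay.nonempty : Nonempty LongRay := by
  obtain ⟨x⟩ : Nonempty OmegaOne := inferInstance
  obtain ⟨y, hy⟩ := exists_gt (ClosedLongRay.ofOmegaOne x)
  exact ⟨⟨y, not_isMin_of_lt hy⟩⟩

/-- The long ray contains uncountably many disjoint open intervals. -/
theorem LongRay.not_separableSpace : ¬ TopologicalSpace.SeparableSpace LongRay := by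
  intro _
  have hmin : ∀ (α : OmegaOne) (r : ℝ) (hr : r ∈ Ioo (0 : ℝ) 1),
      ¬ IsMin (toLex (α, ⟨r, hr.1.le, hr.2⟩) : ClosedLongRay) := fun α r hr =>
    not_isMin_of_lt (b := ClosedLongRay.ofOmegaOne α)
      ((ClosedLongRay.lt_iff _ (toLex (α, ⟨r, hr.1.le, hr.2⟩))).2 (Or.inr ⟨rfl, hr.1⟩))
  let p : OmegaOne → Ioo (0 : ℝ) 1 → LongRay := fun α r => ⟨_, hmin α r r.2⟩
  have hp : ∀ α β r s, p α r < p β s ↔ α < β ∨ α = β ∧ r < s := fun α β r s =>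
    ClosedLongRay.lt_iff _ _
  have h := Pairwise.countable_of_isOpen_disjoint (α := LongRay)
    (s := fun α => Ioo (p α ⟨1 / 4, by norm_num⟩) (p α ⟨3 / 4, by norm_num⟩)) ?_
    (fun _ => isOpen_Ioo) fun α => ⟨p α ⟨1 / 2, by norm_num⟩,
      (hp _ _ _ _).2 (Or.inr ⟨rfl, Subtype.mk_lt_mk.2 (by norm_num)⟩),
      (hp _ _ _ _).2 (Or.inr ⟨rfl, Subtype.mk_lt_mk.2 (by norm_num)⟩)⟩
  · exact not_countable (α := OmegaOne) h
  · have key : ∀ α β : OmegaOne, α < β →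
        Disjoint (Ioo (p α ⟨1 / 4, by norm_num⟩) (p α ⟨3 / 4, by norm_num⟩))
          (Ioo (p β ⟨1 / 4, by norm_num⟩) (p β ⟨3 / 4, by norm_num⟩)) := fun α β h =>
      disjoint_left.2 fun x hx hx' =>
        lt_asymm (hx.2.trans ((hp _ _ _ _).2 (Or.inl h))) hx'.1
    intro α β h
    exact h.lt_or_gt.elim (key α β) fun h => (key β α h).symm

/-! ### Foliating the region between two curves -/

/-- The continuous piecewise affine function on the unit interval with value `y k` at `k / N`. -/
noncomputable def piecewiseAffine (N : ℕ) (y : ℕ → ℝ) : C(I, ℝ) :=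
  y 0 • 1 + ∑ k ∈ Finset.range N,
    (y (k + 1) - y k) • (⟨fun s => max 0 (min 1 (N * (s : ℝ) - k)), by fun_prop⟩ : C(I, ℝ))

theorem piecewiseAffine_apply (N : ℕ) (y : ℕ → ℝ) (s : I) :
    piecewiseAffine N y s = y 0 + ∑ k ∈ Finset.range N,
      (y (k + 1) - y k) * max 0 (min 1 (N * (s : ℝ) - k)) := by
  simp [piecewiseAffine, ContinuousMap.sum_apply]

/-- At j / N the ramps of index below j equal 1 and the others 0, so the sum telescopes. -/
theorem piecewiseAffine_apply_node {N j : ℕ} (y : ℕ → ℝ) {s : I} (hj : j ≤ N)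
    (hs : N * (s : ℝ) = j) : piecewiseAffine N y s = y j := by
  rw [piecewiseAffine_apply, hs, ← Finset.sum_range_add_sum_Ico _ hj,
    Finset.sum_eq_zero (s := Finset.Ico j N), add_zero, Finset.sum_congr rfl (g := fun k =>
    y (k + 1) - y k), Finset.sum_range_sub, add_sub_cancel]
  · intro k hk
    have : (k : ℝ) + 1 ≤ j := by exact_mod_cast Finset.mem_range.1 hk
    rw [min_eq_left (by linarith), max_eq_right zero_le_one, mul_one]
  · intro k hk
    have : (j : ℝ) ≤ k := by exact_mod_cast (Finset.mem_Ico.1 hk).1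
    rw [max_eq_left ((min_le_right _ _).trans (by linarith)), mul_zero]

theorem piecewiseAffine_strictMono {N : ℕ} {y : ℕ → ℝ} (hN : 0 < N)
    (hy : ∀ k < N, y k < y (k + 1)) : StrictMono (piecewiseAffine N y) := by
  intro s s' hss
  have hN' : (0 : ℝ) < N := by exact_mod_cast hN
  have hlt : (N : ℝ) * s < N * s' := mul_lt_mul_of_pos_left hss hN'
  rw [piecewiseAffine_apply, piecewiseAffine_apply]
  -- All ramps are monotone, and the one of index ⌊N s⌋ is strictly increasing just to the right of
  -- s.
  refine add_lt_add_right (Finset.sum_lt_sum (fun k hk => ?_) ⟨⌊(N : ℝ) * s⌋₊, ?_, ?_⟩) _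
  · exact mul_le_mul_of_nonneg_left (max_le_max le_rfl (min_le_min le_rfl (by linarith)))
      (sub_pos.2 (hy k (Finset.mem_range.1 hk))).le
  · have h1 : (N : ℝ) * s < N := hlt.trans_le (mul_le_of_le_one_right hN'.le s'.2.2)
    exact Finset.mem_range.2 ((Nat.floor_lt (mul_nonneg hN'.le s.2.1)).2 h1)
  · have h1 : (N : ℝ) * s < N := hlt.trans_le (mul_le_of_le_one_right hN'.le s'.2.2)
    have h0 : (0 : ℝ) ≤ N * s := mul_nonneg hN'.le s.2.1
    refine mul_lt_mul_of_pos_left ?_ (sub_pos.2 (hy _ ((Nat.floor_lt h0).2 h1)))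
    have h2 := Nat.floor_le h0
    have h3 := Nat.lt_floor_add_one ((N : ℝ) * s)
    rw [min_eq_right (by linarith), max_eq_right (by linarith)]
    exact lt_max_of_lt_right (lt_min (by linarith) (by linarith))

/-- Conditions that each hold near `0` hold below the terms of a sequence that decreases to `0`. -/
theorem exists_strictAnti_forall_lt {P : ℕ → ℝ → Prop} (h : ∀ n, ∀ᶠ t in 𝓝[>] (0 : ℝ), P n t) :
    ∃ e : ℕ → ℝ, StrictAnti e ∧ (∀ n, 0 < e n) ∧ Tendsto e atTop (𝓝 0) ∧
      ∀ n t, 0 < t → t < e n → P n t := by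
  choose d hd hP using fun n => mem_nhdsGT_iff_exists_Ioo_subset.1 (h n)
  -- The partial products of the `b i` lie below each factor, hence below `d n`, and decrease at
  -- least geometrically.
  let b : ℕ → ℝ := fun n => min (1 / 2) (d n)
  have hb : ∀ n, 0 < b n := fun n => lt_min (by norm_num) (hd n)
  have hb2 : ∀ n, b n ≤ 1 / 2 := fun n => min_le_left _ _
  let e : ℕ → ℝ := fun n => ∏ i ∈ Finset.range (n + 1), b i
  have he : ∀ n, 0 < e n := fun n => Finset.prod_pos fun i _ => hb i
  have hpow : ∀ n, ∏ i ∈ Finset.range n, b i ≤ (1 / 2) ^ n := fun n => by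
    simpa using Finset.prod_le_prod (s := Finset.range n) (fun i _ => (hb i).le) fun i _ => hb2 i
  refine ⟨e, strictAnti_nat_of_succ_lt fun n => ?_, he, ?_, fun n t h0 ht => hP n ⟨h0, ?_⟩⟩
  · have : e (n + 1) = e n * b (n + 1) := Finset.prod_range_succ _ _
    rw [this]
    exact mul_lt_of_lt_one_right (he n) ((hb2 _).trans_lt (by norm_num))
  · refine squeeze_zero (fun n => (he n).le) (fun n => hpow (n + 1)) ?_
    exact (tendsto_pow_atTop_nhds_zero_of_lt_one (by norm_num) (by norm_num)).comp
      (tendsto_add_atTop_nat 1)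
  · have h1 : e n = (∏ i ∈ Finset.range n, b i) * b n := Finset.prod_range_succ _ _
    have h2 : ∏ i ∈ Finset.range n, b i ≤ 1 := (hpow n).trans (pow_le_one₀ (by norm_num) (by norm_num))
    calc t < e n := ht
      _ ≤ b n := h1 ▸ mul_le_of_le_one_left (hb n).le h2
      _ ≤ d n := min_le_right _ _

/-- The region between the first and the last curve of a family indexed by the unit interval is
foliated by curves `t ↦ g t s`, in such a way that, for a dense set of parameters `s`, this
curve coincides with the given one near `0`. -/
theorem exists_foliation (γ : I → ℝ → ℝ) (hc : ∀ s, ContinuousOn (γ s) (Ioi 0))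
    (hlt : ∀ s s', s < s' → ∀ᶠ t in 𝓝[>] (0 : ℝ), γ s t < γ s' t) :
    ∃ w : ℝ, 0 < w ∧ ∃ g : C(Ioo 0 w, C(I, ℝ)),
      (∀ t, StrictMono (g t) ∧ g t 0 = γ 0 t ∧ g t 1 = γ 1 t) ∧
      ∀ s s', s < s' → ∃ d ∈ Ioo s s', ∃ δ > 0, ∀ t : Ioo 0 w, (t : ℝ) < δ → g t d = γ d t := by
  let q : ℕ → ℕ → I := fun n k => projIcc 0 1 zero_le_one (k / 2 ^ n)
  have hq : ∀ n k, k ≤ 2 ^ n → (q n k : ℝ) = k / 2 ^ n := fun n k hk => by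
    have : (k : ℝ) ≤ 2 ^ n := by exact_mod_cast hk
    simp only [q]
    rw [projIcc_of_mem zero_le_one ⟨by positivity, (div_le_one (by positivity)).2 this⟩]
  have hqlt : ∀ n, ∀ k < 2 ^ n, q n k < q n (k + 1) := fun n k hk => by
    rw [← Subtype.coe_lt_coe, hq n k hk.le, hq n (k + 1) hk]
    push_cast
    gcongr
    linarith
  obtain ⟨e, he, hpos, hlim, hP⟩ := exists_strictAnti_forall_lt
    (P := fun n t => ∀ k < 2 ^ n, γ (q n k) t < γ (q n (k + 1)) t) fun n =>
      (finite_Iio (2 ^ n)).eventually_all.2 fun k hk => hlt _ _ (hqlt n k hk)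
  -- All the conditions on a leaf profile at abscissa t are convex, so local continuous choices glue
  -- by a partition of unity. The index n + 2 is matched to the lower end `e (m + 3)` of the windows
  -- below: there t' < e (n + 2) forces n ≤ m, and level-n nodes are level-m nodes.
  let T : Ioo 0 (e 0) → Set C(I, ℝ) := fun t =>
    {g | StrictMono g ∧ g 0 = γ 0 t ∧ g 1 = γ 1 t ∧
      ∀ n, (t : ℝ) < e (n + 2) → ∀ k ≤ 2 ^ n, g (q n k) = γ (q n k) t}
  have hT : ∀ t, Convex ℝ (T t) := by
    rintro t g ⟨hg, hg0, hg1, hgn⟩ h ⟨hh, hh0, hh1, hhn⟩ a b ha hb hab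
    have key : ∀ s y, g s = y → h s = y → (a • g + b • h) s = y := fun s y h1 h2 => by
      simp [h1, h2, ← add_mul, hab]
    refine ⟨fun s s' hss => ?_, key _ _ hg0 hh0, key _ _ hg1 hh1, fun n hn k hk =>
      key _ _ (hgn n hn k hk) (hhn n hn k hk)⟩
    have h1 := hg hss
    have h2 := hh hss
    simp only [ContinuousMap.add_apply, ContinuousMap.smul_apply, smul_eq_mul]
    rcases ha.eq_or_lt with rfl | ha
    · have : b = 1 := by linarith
      simpa [this] using h2
    · nlinarith [mul_pos ha (sub_pos.2 h1), mul_nonneg hb (sub_pos.2 h2).le]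
  have hloc : ∀ t, ∃ U ∈ 𝓝 t, ∃ g : Ioo 0 (e 0) → C(I, ℝ), ContinuousOn g U ∧
      ∀ t' ∈ U, g t' ∈ T t' := by
    intro t
    -- This locates m with e (m + 1) ≤ t < e m. Interpolation at level m is increasing below `e m`,
    -- and the window reaches below `e (m + 1)` so as to be a neighbourhood of t.
    have hex : ∃ n, e n ≤ t := (hlim.eventually_le_const t.2.1).exists
    obtain ⟨m, hm⟩ : ∃ m, Nat.find hex = m + 1 := Nat.exists_eq_succ_of_ne_zero fun h => by
      have := Nat.find_spec hex
      rw [h] at this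
      exact this.not_gt t.2.2
    have htm : (t : ℝ) < e m := not_le.1 (Nat.find_min hex (by omega))
    have hmt : e (m + 3) < t := (he (by omega : m + 1 < m + 3)).trans_le
      (hm ▸ Nat.find_spec hex)
    refine ⟨{t' | e (m + 3) < t' ∧ (t' : ℝ) < e m}, ?_, fun t' =>
      piecewiseAffine (2 ^ m) fun k => γ (q m k) t', ?_, ?_⟩
    · exact (continuous_subtype_val.continuousAt.eventually (lt_mem_nhds hmt)).and
        (continuous_subtype_val.continuousAt.eventually (gt_mem_nhds htm))
    · have hγ : ∀ s, Continuous fun t' : Ioo 0 (e 0) => γ s t' := fun s =>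
        (hc s).comp_continuous continuous_subtype_val fun t' => t'.2.1
      exact (((hγ _).smul continuous_const).add (continuous_finsetSum _ fun k _ =>
        ((hγ _).sub (hγ _)).smul continuous_const)).continuousOn
    · rintro t' ⟨h1, h2⟩
      have hnode : ∀ n ≤ m, ∀ k ≤ 2 ^ n,
          piecewiseAffine (2 ^ m) (fun k => γ (q m k) t') (q n k) = γ (q n k) t' := by
        intro n hn k hk
        obtain ⟨j, rfl⟩ := Nat.exists_eq_add_of_le hn
        have hle : k * 2 ^ j ≤ 2 ^ (n + j) := by
          rw [pow_add]
          exact Nat.mul_le_mul_right _ hk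
        have heq : q (n + j) (k * 2 ^ j) = q n k := by
          refine Subtype.ext ?_
          rw [hq _ _ hle, hq _ _ hk]
          push_cast
          rw [pow_add]
          field_simp
        rw [← heq]
        refine piecewiseAffine_apply_node _ hle ?_
        rw [hq _ _ hle]
        push_cast
        field_simp
      have hq0 : q 0 0 = 0 := Subtype.ext (by simp [hq])
      have hq1 : q 0 1 = 1 := Subtype.ext (by simp [hq])
      refine ⟨piecewiseAffine_strictMono (by positivity) (hP m t' t'.2.1 h2), ?_, ?_, ?_⟩
      · simpa [hq0] using hnode 0 (Nat.zero_le _) 0 (by simp)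
      · simpa [hq1] using hnode 0 (Nat.zero_le _) 1 (by simp)
      · intro n hn
        refine hnode n ?_
        by_contra! hlt
        exact (h1.trans hn).not_ge (he.antitone (by omega))
  obtain ⟨g, hg⟩ := exists_continuous_forall_mem_convex_of_local hT hloc
  refine ⟨e 0, hpos 0, g, fun t => ⟨(hg t).1, (hg t).2.1, (hg t).2.2.1⟩, fun s s' hss => ?_⟩
  obtain ⟨n, hn⟩ := exists_pow_lt_of_lt_one (sub_pos.2 (Subtype.coe_lt_coe.2 hss))
    (by norm_num : (1 / 2 : ℝ) < 1)
  have h2 : (0 : ℝ) < 2 ^ n := by positivity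
  rw [div_pow, one_pow, div_lt_iff₀ h2] at hn
  have h3 := Nat.floor_le (mul_nonneg s.2.1 h2.le)
  have h4 := Nat.lt_floor_add_one ((s : ℝ) * 2 ^ n)
  set k := ⌊(s : ℝ) * 2 ^ n⌋₊
  have h5 : ((k + 1 : ℕ) : ℝ) < s' * 2 ^ n := by push_cast; linarith
  have hk : k + 1 ≤ 2 ^ n := by
    have : ((k + 1 : ℕ) : ℝ) < 2 ^ n := h5.trans_le (mul_le_of_le_one_left h2.le s'.2.2)
    exact_mod_cast this.le
  refine ⟨q n (k + 1), ⟨?_, ?_⟩, e (n + 2), hpos _, fun t ht => (hg t).2.2.2 n ht _ hk⟩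
  · rw [← Subtype.coe_lt_coe, hq _ _ hk, lt_div_iff₀ h2]
    push_cast
    exact h4
  · rw [← Subtype.coe_lt_coe, hq _ _ hk, div_lt_iff₀ h2]
    exact h5

/-- Joint continuity in t and s, the form needed for charts, follows from continuity into C(I, ℝ).
The value 0 chosen outside the strip plays no role. -/
theorem exists_foliation_continuousOn (γ : I → ℝ → ℝ) (hc : ∀ s, ContinuousOn (γ s) (Ioi 0))
    (hlt : ∀ s s', s < s' → ∀ᶠ t in 𝓝[>] (0 : ℝ), γ s t < γ s' t) :
    ∃ w : ℝ, 0 < w ∧ ∃ θ : ℝ → I → ℝ, ContinuousOn (Function.uncurry θ) (Ioo 0 w ×ˢ univ) ∧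
      (∀ t ∈ Ioo 0 w, StrictMono (θ t) ∧ θ t 0 = γ 0 t ∧ θ t 1 = γ 1 t) ∧
      ∀ s s', s < s' → ∃ d ∈ Ioo s s', ∀ᶠ t in 𝓝[>] (0 : ℝ), θ t d = γ d t := by
  obtain ⟨w, hw, g, hg, hd⟩ := exists_foliation γ hc hlt
  classical
  let θ : ℝ → I → ℝ := fun t s => if h : t ∈ Ioo 0 w then g ⟨t, h⟩ s else 0
  have hθ : ∀ t (h : t ∈ Ioo 0 w) s, θ t s = g ⟨t, h⟩ s := fun t h s => dif_pos h
  refine ⟨w, hw, θ, ?_, fun t ht => ?_, fun s s' hss => ?_⟩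
  · rw [continuousOn_iff_continuous_domRestrict]
    have : Continuous fun p : (Ioo 0 w ×ˢ univ : Set (ℝ × I)) => g ⟨p.1.1, p.2.1⟩ p.1.2 := by
      fun_prop
    convert this using 1
    ext p
    exact hθ _ p.2.1 _
  · rw [show θ t = g ⟨t, ht⟩ from funext (hθ t ht)]
    exact hg ⟨t, ht⟩
  · obtain ⟨d, hds, δ, hδ, h⟩ := hd s s' hss
    refine ⟨d, hds, ?_⟩
    filter_upwards [Ioo_mem_nhdsGT (lt_min hw hδ)] with t ht
    rw [hθ t ⟨ht.1, ht.2.trans_le (min_le_left _ _)⟩]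
    exact h _ (ht.2.trans_le (min_le_right _ _))

/-! ### The topology of the Nyikosisation -/

namespace Nyikosisation

variable {a : ℝ} {c : CurveFamily LongRay a}

theorem plane_injective : Function.Injective (plane : OpenHalfPlane → Nyikosisation c) :=
  fun _ _ h => plane.inj h

theorem ray_injective : Function.Injective (ray : LongRay → Nyikosisation c) :=
  fun _ _ h => ray.inj h

theorem continuous_curve (u : LongRay) : Continuous fun p : OpenHalfPlane => c.curve u p.1.1 :=
  (c.continuousOn_curve u).comp_continuous (by fun_prop) fun p => p.2

theorem isOpen_sector (u v : LongRay) (w : ℝ) : IsOpen (sector c u v w) := by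
  have h1 : Continuous fun p : OpenHalfPlane => p.1.1 := by fun_prop
  have h2 : Continuous fun p : OpenHalfPlane => p.1.2 := by fun_prop
  exact (isOpen_lt h1 continuous_const).inter
    ((isOpen_lt (continuous_curve u) h2).inter (isOpen_lt h2 (continuous_curve v)))

theorem plane_mem_basicNhd {u v : LongRay} {w : ℝ} {p : OpenHalfPlane} :
    plane p ∈ basicNhd c u v w ↔ p ∈ sector c u v w := by
  simp [basicNhd]

theorem ray_mem_basicNhd {u v x : LongRay} {w : ℝ} :
    ray x ∈ basicNhd c u v w ↔ x ∈ Ioo u v := by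
  simp [basicNhd]

theorem isOpen_basicNhd {u v : LongRay} {w : ℝ} (hw : 0 < w) : IsOpen (basicNhd c u v w) := by
  refine ⟨?_, fun x hx => ⟨u, v, w, (ray_mem_basicNhd.1 hx).1, (ray_mem_basicNhd.1 hx).2, hw,
    Subset.rfl⟩⟩
  convert isOpen_sector (c := c) u v w using 1
  ext p
  exact plane_mem_basicNhd

theorem mem_nhds_ray {x : LongRay} {S : Set (Nyikosisation c)} :
    S ∈ 𝓝 (ray x) ↔ ∃ u v w, u < x ∧ x < v ∧ 0 < w ∧ basicNhd c u v w ⊆ S := by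
  constructor
  · intro h
    obtain ⟨T, hTS, hT, hx⟩ := mem_nhds_iff.1 h
    obtain ⟨u, v, w, hu, hv, hw, h⟩ := hT.2 x hx
    exact ⟨u, v, w, hu, hv, hw, h.trans hTS⟩
  · rintro ⟨u, v, w, hu, hv, hw, h⟩
    exact mem_of_superset ((isOpen_basicNhd hw).mem_nhds (ray_mem_basicNhd.2 ⟨hu, hv⟩)) h

theorem isOpenEmbedding_plane : IsOpenEmbedding (plane : OpenHalfPlane → Nyikosisation c) := by
  refine .of_continuous_injective_isOpenMap ⟨fun S hS => hS.1⟩ plane_injective fun A hA => ⟨?_, ?_⟩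
  · rwa [preimage_image_eq _ plane_injective]
  · rintro x ⟨p, -, hp⟩
    cases hp

theorem range_plane_eq : range (plane : OpenHalfPlane → Nyikosisation c) = (range ray)ᶜ := by
  ext (p | x) <;> simp

theorem isEmbedding_ray : IsEmbedding (ray : LongRay → Nyikosisation c) := by
  refine ⟨isInducing_iff_nhds.2 fun x => le_antisymm ?_ ?_, ray_injective⟩
  · rintro S ⟨T, hT, hTS⟩
    obtain ⟨u, v, w, hu, hv, hw, h⟩ := mem_nhds_ray.1 hT
    exact mem_of_superset (Ioo_mem_nhds hu hv) fun y hy => hTS (h (ray_mem_basicNhd.2 hy))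
  · intro S hS
    obtain ⟨u, v, hx, h⟩ := mem_nhds_iff_exists_Ioo_subset.1 hS
    exact ⟨basicNhd c u v 1, mem_nhds_ray.2 ⟨u, v, 1, hx.1, hx.2, one_pos, Subset.rfl⟩,
      fun y hy => h (ray_mem_basicNhd.1 hy)⟩

instance t2Space : T2Space (Nyikosisation c) := by
  have hpr : ∀ (p : OpenHalfPlane) (x : LongRay), ∃ S T : Set (Nyikosisation c), IsOpen S ∧ IsOpen T ∧
      plane p ∈ S ∧ ray x ∈ T ∧ Disjoint S T := by
    intro p x
    obtain ⟨u, hu⟩ := exists_lt x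
    obtain ⟨v, hv⟩ := exists_gt x
    have h2 : 0 < p.1.1 / 2 := half_pos p.2
    refine ⟨plane '' {q | p.1.1 / 2 < q.1.1}, basicNhd c u v (p.1.1 / 2),
      isOpenEmbedding_plane.isOpenMap _ (isOpen_lt continuous_const (by fun_prop)),
      isOpen_basicNhd h2, mem_image_of_mem _ (half_lt_self p.2), ray_mem_basicNhd.2 ⟨hu, hv⟩, ?_⟩
    rw [disjoint_left]
    rintro _ ⟨q, hq, rfl⟩ hq'
    exact (plane_mem_basicNhd.1 hq').1.not_gt hq
  have hrr : ∀ x y : LongRay, x < y → ∃ S T : Set (Nyikosisation c), IsOpen S ∧ IsOpen T ∧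
      -- The curve of an intermediate index z separates the two neighbourhoods: one lies strictly
      -- below it, the other strictly above.
      ray x ∈ S ∧ ray y ∈ T ∧ Disjoint S T := by
    intro x y hxy
    obtain ⟨z, hxz, hzy⟩ : ∃ z, x < z ∧ z < y := by
      obtain ⟨z, h1, h2⟩ := exists_between (show x.1 < y.1 from hxy)
      exact ⟨⟨z, not_isMin_of_lt h1⟩, h1, h2⟩
    obtain ⟨u, hu⟩ := exists_lt x
    obtain ⟨v, hv⟩ := exists_gt y
    refine ⟨basicNhd c u z 1, basicNhd c z v 1, isOpen_basicNhd one_pos, isOpen_basicNhd one_pos,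
      ray_mem_basicNhd.2 ⟨hu, hxz⟩, ray_mem_basicNhd.2 ⟨hzy, hv⟩, ?_⟩
    rw [disjoint_left]
    rintro (p | s) h1 h2
    · exact lt_asymm (plane_mem_basicNhd.1 h1).2.2 (plane_mem_basicNhd.1 h2).2.1
    · exact lt_asymm (ray_mem_basicNhd.1 h1).2 (ray_mem_basicNhd.1 h2).1
  refine ⟨fun X Y hXY => ?_⟩
  match X, Y, hXY with
  | plane p, plane q, h =>
    obtain ⟨S, T, hS, hT, hp, hq, hd⟩ := t2_separation fun hpq : p = q => h (congrArg _ hpq)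
    exact ⟨_, _, isOpenEmbedding_plane.isOpenMap _ hS, isOpenEmbedding_plane.isOpenMap _ hT,
      mem_image_of_mem _ hp, mem_image_of_mem _ hq, (disjoint_image_iff plane_injective).2 hd⟩
  | plane p, ray x, _ => exact hpr p x
  | ray x, plane p, _ =>
    obtain ⟨S, T, hS, hT, h1, h2, hd⟩ := hpr p x
    exact ⟨T, S, hT, hS, h2, h1, hd.symm⟩
  | ray x, ray y, h =>
    rcases lt_or_gt_of_ne fun hxy : x = y => h (congrArg _ hxy) with h | h
    · exact hrr x y h
    · obtain ⟨S, T, hS, hT, h1, h2, hd⟩ := hrr y x h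
      exact ⟨T, S, hT, hS, h2, h1, hd.symm⟩

/-- The inclusion of the open half-plane, extended by a constant to the plane. -/
noncomputable def ofPlane (c : CurveFamily LongRay a) (q : ℝ × ℝ) : Nyikosisation c :=
  open Classical in if h : 0 < q.1 then plane ⟨q, h⟩ else ray (Classical.arbitrary LongRay)

theorem ofPlane_eq {q : ℝ × ℝ} (h : 0 < q.1) : ofPlane c q = plane ⟨q, h⟩ :=
  dif_pos h

theorem map_ofPlane_nhds {q : ℝ × ℝ} (h : 0 < q.1) :
    map (ofPlane c) (𝓝 q) = 𝓝 (ofPlane c q) := by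
  have ho : IsOpen {p : ℝ × ℝ | 0 < p.1} := isOpen_lt continuous_const continuous_fst
  rw [ofPlane_eq h, ← isOpenEmbedding_plane.map_nhds_eq,
    ← ho.isOpenEmbedding_subtypeVal.map_nhds_eq ⟨q, h⟩, map_map]
  exact congrArg (map · _) (funext fun p => ofPlane_eq p.2)

/-! ### Charts at the added points -/

theorem exists_chart_on_box (x : LongRay) : ∃ w : ℝ, ∃ hw : 0 < w,
    ∃ J : Ioo (0 : I) 1 × Ico (0 : ℝ) w → Nyikosisation c,
      IsOpenEmbedding J ∧ ∃ s, J (s, ⟨0, le_rfl, hw⟩) = ray x := by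
  obtain ⟨u, hu⟩ := exists_lt x
  obtain ⟨v, hv⟩ := exists_gt x
  obtain ⟨τ₀, hτ₀, him⟩ := LongRay.exists_parametrization (hu.trans hv)
  obtain ⟨τ, hτ, him⟩ : ∃ τ : I → LongRay, StrictMono τ ∧ range τ = Icc u v := by
    refine ⟨fun s => τ₀ s, fun s s' h => hτ₀ s.2 s'.2 h, ?_⟩
    rw [← him, image_eq_range]
  obtain ⟨w, hw, θ, hθc, hθ, hd⟩ := exists_foliation_continuousOn (fun s => c.curve (τ s))
    (fun s => c.continuousOn_curve _) fun s s' h => c.eventually_lt _ _ (hτ h)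
  have hτI : ∀ s, τ s ∈ Icc u v := fun s => him ▸ mem_range_self s
  -- Leaves and curves are compared through a parameter d whose leaf is eventually its own curve. As
  -- z may lie below u, outside the range of `τ`, it is first replaced by `max z (τ 0)`.
  have hlow : ∀ (s : I) (z : LongRay), 0 < s → z < τ s → ∃ d < s, z < τ d ∧
      ∀ᶠ t in 𝓝[>] (0 : ℝ), c.curve z t < θ t d := by
    intro s z h0 hz
    have hm : max z (τ 0) ∈ range τ :=
      him ▸ ⟨(hτI 0).1.trans (le_max_right _ _), max_le (hz.le.trans (hτI s).2) (hτI 0).2⟩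
    obtain ⟨r, hr⟩ := hm
    have hrs : r < s := hτ.lt_iff_lt.1 (hr ▸ max_lt hz (hτ h0))
    obtain ⟨d, hds, hd⟩ := hd r s hrs
    have hzd : z < τ d := ((le_max_left _ _).trans_eq hr.symm).trans_lt (hτ hds.1)
    refine ⟨d, hds.2, hzd, ?_⟩
    filter_upwards [hd, c.eventually_lt _ _ hzd] with t h1 h2
    rwa [h1]
  have hupp : ∀ (s : I) (z : LongRay), s < 1 → τ s < z → ∃ d > s, τ d < z ∧
      ∀ᶠ t in 𝓝[>] (0 : ℝ), θ t d < c.curve z t := by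
    intro s z h0 hz
    have hm : min z (τ 1) ∈ range τ :=
      him ▸ ⟨le_min ((hτI s).1.trans hz.le) (hτI 1).1, (min_le_right _ _).trans (hτI 1).2⟩
    obtain ⟨r, hr⟩ := hm
    have hrs : s < r := hτ.lt_iff_lt.1 (hr ▸ lt_min hz (hτ h0))
    obtain ⟨d, hds, hd⟩ := hd s r hrs
    have hzd : τ d < z := (hτ hds.2).trans_le (hr.trans_le (min_le_left _ _))
    refine ⟨d, hds.1, hzd, ?_⟩
    filter_upwards [hd, c.eventually_lt _ _ hzd] with t h1 h2
    rwa [h1]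
  have hcont : ∀ t ∈ Ioo 0 w, ∀ s, ContinuousAt (Function.uncurry θ) (t, s) := fun t ht s =>
    hθc.continuousAt ((isOpen_Ioo.prod isOpen_univ).mem_nhds ⟨ht, mem_univ _⟩)
  classical
  let J : Ioo (0 : I) 1 × Ico (0 : ℝ) w → Nyikosisation c := fun p =>
    if (p.2 : ℝ) = 0 then ray (τ p.1) else ofPlane c (p.2, θ p.2 p.1)
  have hJ0 : ∀ p : Ioo (0 : I) 1 × Ico (0 : ℝ) w, (p.2 : ℝ) = 0 → J p = ray (τ p.1) :=
    fun p hp => if_pos hp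
  have hJ1 : ∀ p : Ioo (0 : I) 1 × Ico (0 : ℝ) w, 0 < (p.2 : ℝ) →
      J p = ofPlane c (p.2, θ p.2 p.1) := fun p hp => if_neg hp.ne'
  have hJt : ∀ (s : Ioo (0 : I) 1) (t : ℝ) (ht : t ∈ Ioo 0 w),
      J (s, ⟨t, ht.1.le, ht.2⟩) = plane ⟨(t, θ t s), ht.1⟩ := fun s t ht => by
    rw [hJ1 _ ht.1, ofPlane_eq ht.1]
  refine ⟨w, hw, J, .of_continuous_injective_isOpenMap ?_ ?_ ?_, ?_⟩
  · refine continuous_iff_continuousAt.2 fun p => ?_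
    rcases p.2.2.1.eq_or_lt with hp | hp
    · intro S hS
      rw [hJ0 p hp.symm] at hS
      obtain ⟨u', v', w', hu', hv', hw', hS⟩ := mem_nhds_ray.1 hS
      obtain ⟨d, hds, hud, hd⟩ := hlow p.1 u' p.1.2.1 hu'
      obtain ⟨d', hds', hud', hd'⟩ := hupp p.1 v' p.1.2.2 hv'
      obtain ⟨δ, hδ, hsub⟩ := mem_nhdsGT_iff_exists_Ioo_subset.1 (hd.and hd')
      have h1 : ∀ᶠ q : Ioo (0 : I) 1 × Ico (0 : ℝ) w in 𝓝 p, d < q.1.1 ∧ q.1.1 < d' :=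
        ((by fun_prop : Continuous fun q : Ioo (0 : I) 1 × Ico (0 : ℝ) w => q.1.1).continuousAt
          ).eventually (Ioo_mem_nhds hds hds')
      have h2 : ∀ᶠ q : Ioo (0 : I) 1 × Ico (0 : ℝ) w in 𝓝 p, (q.2 : ℝ) < min δ w' :=
        ((by fun_prop : Continuous fun q : Ioo (0 : I) 1 × Ico (0 : ℝ) w => q.2.1).continuousAt
          ).eventually (gt_mem_nhds (hp.symm.trans_lt (lt_min hδ hw')))
      rw [mem_map]
      filter_upwards [h1, h2] with q hq1 hq2
      refine hS ?_
      rcases q.2.2.1.eq_or_lt with hq | hq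
      · rw [hJ0 q hq.symm, ray_mem_basicNhd]
        exact ⟨hud.trans (hτ hq1.1), (hτ hq1.2).trans hud'⟩
      · rw [hJ1 q hq, ofPlane_eq hq, plane_mem_basicNhd]
        have h := hsub ⟨hq, hq2.trans_le (min_le_left _ _)⟩
        have hm := (hθ q.2 ⟨hq, q.2.2.2⟩).1
        exact ⟨hq2.trans_le (min_le_right _ _), h.1.trans (hm hq1.1), (hm hq1.2).trans h.2⟩
    · have hev : (fun q : Ioo (0 : I) 1 × Ico (0 : ℝ) w => ofPlane c (q.2, θ q.2 q.1)) =ᶠ[𝓝 p] J := by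
        have : ∀ᶠ q : Ioo (0 : I) 1 × Ico (0 : ℝ) w in 𝓝 p, 0 < (q.2 : ℝ) :=
          ((by fun_prop : Continuous fun q : Ioo (0 : I) 1 × Ico (0 : ℝ) w => q.2.1).continuousAt
            ).eventually (lt_mem_nhds hp)
        filter_upwards [this] with q hq using (hJ1 q hq).symm
      refine ContinuousAt.congr ?_ hev
      have h1 : ContinuousAt (ofPlane c) (p.2, θ p.2 p.1) := (map_ofPlane_nhds hp).le
      refine ContinuousAt.comp (f := fun q : Ioo (0 : I) 1 × Ico (0 : ℝ) w =>
        ((q.2 : ℝ), θ q.2 q.1)) h1 (ContinuousAt.prodMk (by fun_prop) ?_)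
      exact ContinuousAt.comp (f := fun q : Ioo (0 : I) 1 × Ico (0 : ℝ) w =>
        ((q.2 : ℝ), (q.1 : I))) (hcont p.2 ⟨hp, p.2.2.2⟩ p.1) (by fun_prop)
  · rintro ⟨s, t, ht⟩ ⟨s', t', ht'⟩ h
    rcases ht.1.eq_or_lt with rfl | h0 <;> rcases ht'.1.eq_or_lt with rfl | h0'
    · rw [hJ0 _ rfl, hJ0 _ rfl] at h
      exact congrArg (·, _) (Subtype.ext (hτ.injective (ray_injective h)))
    · rw [hJ0 _ rfl, hJt s' t' ⟨h0', ht'.2⟩] at h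
      cases h
    · rw [hJ0 (s', _) rfl, hJt s t ⟨h0, ht.2⟩] at h
      cases h
    · rw [hJt s t ⟨h0, ht.2⟩, hJt s' t' ⟨h0', ht'.2⟩] at h
      have h := congrArg Subtype.val (plane_injective h)
      obtain ⟨rfl, h2⟩ := Prod.mk.inj h
      rw [Subtype.ext ((hθ t ⟨h0, ht.2⟩).1.injective h2)]
  · refine IsOpenMap.of_nhds_le fun p S hS => ?_
    obtain ⟨A, hA, V, hV, hAV⟩ := mem_nhds_prod_iff.1 (mem_map.1 hS)
    obtain ⟨s₁, s₂, hs, hsA⟩ := mem_nhds_iff_exists_Ioo_subset.1 hA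
    obtain ⟨V', hV', hVV⟩ := (mem_nhds_subtype _ _ _).1 hV
    -- points of the half-plane that lie on the leaves between two given ones
    have hplane : ∀ (d₁ d₂ : I), s₁.1 ≤ d₁ → d₂ ≤ s₂.1 → ∀ q : OpenHalfPlane, q.1.1 < w →
        q.1.1 ∈ V' → θ q.1.1 d₁ < q.1.2 → q.1.2 < θ q.1.1 d₂ → plane q ∈ S := by
      rintro d₁ d₂ h1 h2 ⟨⟨t, y⟩, ht⟩ htw htV hy1 hy2
      have hm := (hθ t ⟨ht, htw⟩).1
      have hcs : Continuous (θ t) := continuous_iff_continuousAt.2 fun s =>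
        ContinuousAt.comp (f := fun s : I => (t, s)) (hcont t ⟨ht, htw⟩ s) (by fun_prop)
      obtain ⟨s, rfl⟩ := mem_range_of_exists_le_of_exists_ge hcs ⟨d₁, hy1.le⟩ ⟨d₂, hy2.le⟩
      have h3 : s₁.1 < s := h1.trans_lt (hm.lt_iff_lt.1 hy1)
      have h4 : s < s₂.1 := (hm.lt_iff_lt.1 hy2).trans_le h2
      have hsI : s ∈ Ioo (0 : I) 1 := ⟨s₁.2.1.trans h3, h4.trans s₂.2.2⟩
      have := hAV (show ((⟨s, hsI⟩, ⟨t, ht.le, htw⟩) : Ioo (0 : I) 1 × Ico (0 : ℝ) w) ∈ A ×ˢ V from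
        ⟨hsA ⟨h3, h4⟩, hVV htV⟩)
      rwa [mem_preimage, hJt ⟨s, hsI⟩ t ⟨ht, htw⟩] at this
    rcases p.2.2.1.eq_or_lt with hp | hp
    · rw [hJ0 p hp.symm]
      -- Near the axis the leaves d₁ and d₂ are the curves of index `τ d₁` and `τ d₂`, so a thin
      -- sector between these curves is filled by leaves of parameter between d₁ and d₂.
      obtain ⟨d₁, hd₁, e₁⟩ := hd s₁ p.1 hs.1
      obtain ⟨d₂, hd₂, e₂⟩ := hd p.1 s₂ hs.2
      have hV0 : ∀ᶠ t in 𝓝[>] (0 : ℝ), t ∈ V' :=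
        nhdsWithin_le_nhds (hp ▸ hV')
      obtain ⟨δ, hδ, hsub⟩ := mem_nhdsGT_iff_exists_Ioo_subset.1 ((e₁.and e₂).and hV0)
      refine mem_nhds_ray.2 ⟨τ d₁, τ d₂, min δ w, hτ hd₁.2, hτ hd₂.1, lt_min hδ hw, ?_⟩
      rintro _ (⟨q, hq, rfl⟩ | ⟨z, hz, rfl⟩)
      · obtain ⟨⟨h1, h2⟩, h3⟩ := hsub ⟨q.2, hq.1.trans_le (min_le_left _ _)⟩
        exact hplane d₁ d₂ hd₁.1.le hd₂.2.le q (hq.1.trans_le (min_le_right _ _)) h3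
          (h1.trans_lt hq.2.1) (hq.2.2.trans_eq h2.symm)
      · obtain ⟨s, rfl⟩ : z ∈ range τ :=
          him ▸ ⟨(hτI _).1.trans hz.1.le, hz.2.le.trans (hτI _).2⟩
        have h3 : s₁.1 < s := hd₁.1.trans (hτ.lt_iff_lt.1 hz.1)
        have h4 : s < s₂.1 := (hτ.lt_iff_lt.1 hz.2).trans hd₂.2
        have hsI : s ∈ Ioo (0 : I) 1 := ⟨s₁.2.1.trans h3, h4.trans s₂.2.2⟩
        have := hAV (show ((⟨s, hsI⟩, p.2) : Ioo (0 : I) 1 × Ico (0 : ℝ) w) ∈ A ×ˢ V from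
          ⟨hsA ⟨h3, h4⟩, mem_of_mem_nhds hV⟩)
        rwa [mem_preimage, hJ0 (⟨s, hsI⟩, p.2) hp.symm] at this
    · rw [hJ1 p hp, ofPlane_eq hp, ← isOpenEmbedding_plane.map_nhds_eq, mem_map]
      have hcs : ∀ s : I, ContinuousAt (fun q : OpenHalfPlane => θ q.1.1 s)
          ⟨(p.2, θ p.2 p.1), hp⟩ := fun s =>
        ContinuousAt.comp (x := (⟨(p.2, θ p.2 p.1), hp⟩ : OpenHalfPlane))
          (f := fun q : OpenHalfPlane => (q.1.1, s)) (hcont p.2 ⟨hp, p.2.2.2⟩ s)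
            (by fun_prop)
      have hm := (hθ p.2 ⟨hp, p.2.2.2⟩).1
      have hfst : ContinuousAt (fun q : OpenHalfPlane => q.1.1) ⟨(p.2, θ p.2 p.1), hp⟩ := by
        fun_prop
      have hsnd : ContinuousAt (fun q : OpenHalfPlane => q.1.2) ⟨(p.2, θ p.2 p.1), hp⟩ := by
        fun_prop
      filter_upwards [hfst.eventually (gt_mem_nhds p.2.2.2), hfst.eventually hV',
        (hcs s₁).eventually_lt hsnd (hm hs.1), hsnd.eventually_lt (hcs s₂) (hm hs.2)]
        with q h1 h2 h3 h4
      exact hplane s₁ s₂ le_rfl le_rfl q h1 h2 h3 h4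
  · obtain ⟨s, hs⟩ : x ∈ range τ := him ▸ ⟨hu.le, hv.le⟩
    obtain ⟨r, hr⟩ : u ∈ range τ := him ▸ left_mem_Icc.2 (hu.trans hv).le
    obtain ⟨r', hr'⟩ : v ∈ range τ := him ▸ right_mem_Icc.2 (hu.trans hv).le
    have h0 : 0 < s := unitInterval.nonneg'.trans_lt (hτ.lt_iff_lt.1 (hr ▸ hs ▸ hu))
    have h1 : s < 1 := (hτ.lt_iff_lt.1 (hr' ▸ hs ▸ hv)).trans_le unitInterval.le_one'
    exact ⟨⟨s, h0, h1⟩, (hJ0 _ rfl).trans (congrArg ray hs)⟩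

end Nyikosisation

/-! ### Boundary points of the half-plane have no planar neighbourhood -/

/-- There is no continuous branch of the logarithm on a circle. -/
theorem Complex.not_exists_log_on_sphere {p : ℂ} {ε : ℝ} (hε : 0 < ε) {l : ℂ → ℂ}
    (hl : ContinuousOn l (Metric.sphere p ε))
    (hexp : ∀ q ∈ Metric.sphere p ε, Complex.exp (l q) = q - p) : False := by
  have hmem : ∀ t, circleMap p ε t ∈ Metric.sphere p ε := circleMap_mem_sphere p hε.le
  -- `k` lifts the constant ε through exp, so it is constant; yet following the circle once would
  -- change it by -2πi.
  let k : ℝ → ℂ := fun t => l (circleMap p ε t) - t * Complex.I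
  have hk : Continuous k :=
    (hl.comp_continuous (continuous_circleMap p ε) hmem).sub (by fun_prop)
  have hkexp : ∀ t, Complex.exp (k t) = ε := fun t => by
    rw [Complex.exp_sub, hexp _ (hmem t), circleMap_sub_center, circleMap_zero,
      mul_div_cancel_right₀ _ (Complex.exp_ne_zero _)]
  have hconst : k = fun _ => k 0 :=
    Complex.isCoveringMap_exp.eq_of_comp_eq hk continuous_const
      (funext fun t => Subtype.ext ((hkexp t).trans (hkexp 0).symm)) 0 rfl
  have h := congrFun hconst (2 * Real.pi)
  have hper : circleMap p ε (2 * Real.pi) = circleMap p ε 0 := by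
    simpa using (periodic_circleMap p ε) 0
  simp [k, hper, Real.pi_ne_zero] at h

/-- No half-disc maps continuously onto a neighbourhood of `p` with a continuous section over
a circle around `p`, the point `p` being the image of the centre only. -/
theorem Complex.not_exists_halfDisc_section {f g : ℂ → ℂ} {p : ℂ} {r ε : ℝ} (hr : 0 < r)
    (hε : 0 < ε) (hf : ContinuousOn f {z | ‖z‖ < r ∧ 0 ≤ z.re}) (hf0 : f 0 = p)
    (hfp : ∀ z, ‖z‖ < r → 0 ≤ z.re → z ≠ 0 → f z ≠ p)
    (hg : ContinuousOn g (Metric.sphere p ε))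
    (hgr : ∀ q ∈ Metric.sphere p ε, ‖g q‖ < r ∧ 0 ≤ (g q).re ∧ f (g q) = q) : False := by
  let D : Set ℂ := {w | w.re < Real.log r}
  -- Clamping the argument to [-π/2, π/2] makes `κ` send the whole simply connected half-plane `D`
  -- into the punctured half-disc, with `κ (log z) = z` there. A logarithm of `f ∘ κ - p` on `D`,
  -- composed with `log ∘ g`, becomes a logarithm of q - p on the circle.
  let m : ℝ → ℝ := fun y => max (-(Real.pi / 2)) (min (Real.pi / 2) y)
  have hm : ∀ y, m y ∈ Icc (-(Real.pi / 2)) (Real.pi / 2) := fun y =>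
    ⟨le_max_left _ _, max_le (by linarith [Real.pi_pos]) (min_le_left _ _)⟩
  let κ : ℂ → ℂ := fun w => Complex.exp (w.re + m w.im * Complex.I)
  have hκc : Continuous κ := by fun_prop
  have hκn : ∀ w, ‖κ w‖ = Real.exp w.re := fun w => by simp [κ, Complex.norm_exp]
  have hκr : ∀ w, 0 ≤ (κ w).re := fun w => by
    simp only [κ, Complex.exp_re]
    refine mul_nonneg (Real.exp_pos _).le (Real.cos_nonneg_of_mem_Icc ?_)
    simpa using hm w.im
  have hκD : ∀ w ∈ D, ‖κ w‖ < r := fun w hw => by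
    rw [hκn]
    exact (Real.lt_log_iff_exp_lt hr).1 hw
  have hDo : IsOpen D := isOpen_lt Complex.continuous_re continuous_const
  have hDs : IsSimplyConnected D := by
    have : ContractibleSpace D := (convex_halfSpace_re_lt (Real.log r)).contractibleSpace
      ⟨((Real.log r - 1 : ℝ) : ℂ), by simp⟩
    exact (inferInstance : SimplyConnectedSpace D)
  obtain ⟨L, hLc, hL⟩ := Complex.exists_continuousOn_eqOn_exp_comp hDs hDo
    (g := fun w => f (κ w) - p)
    ((hf.comp hκc.continuousOn fun w hw => ⟨hκD w hw, hκr w⟩).sub continuousOn_const) (by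
      rintro ⟨w, hw, h⟩
      exact hfp _ (hκD w hw) (hκr w) (Complex.exp_ne_zero _) (sub_eq_zero.1 h))
  have hg0 : ∀ q ∈ Metric.sphere p ε, g q ≠ 0 := fun q hq h => by
    have h1 := (hgr q hq).2.2
    rw [h, hf0] at h1
    exact Metric.ne_of_mem_sphere hq hε.ne' h1.symm
  have hgD : ∀ q ∈ Metric.sphere p ε, Complex.log (g q) ∈ D := fun q hq => by
    simp only [D, mem_ofPred_eq, Complex.log_re]
    exact Real.log_lt_log (norm_pos_iff.2 (hg0 q hq)) (hgr q hq).1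
  refine Complex.not_exists_log_on_sphere (p := p) hε (l := fun q => L (Complex.log (g q)))
    (hLc.comp (hg.clog fun q hq => ?_) hgD) fun q hq => ?_
  · rw [Complex.mem_slitPlane_iff]
    rcases (hgr q hq).2.1.eq_or_lt with h | h
    · exact Or.inr fun h' => hg0 q hq (Complex.ext h.symm h')
    · exact Or.inl h
  · have h1 := hL (hgD q hq)
    have h2 : κ (Complex.log (g q)) = g q := by
      have h3 := abs_le.1 (Complex.abs_arg_le_pi_div_two_iff.2 (hgr q hq).2.1)
      simp only [κ, m, Complex.log_im]
      rw [min_eq_right h3.2, max_eq_right h3.1, ← Complex.log_im, Complex.re_add_im,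
        Complex.exp_log (hg0 q hq)]
    simp only [Function.comp_apply, h2, (hgr q hq).2.2] at h1
    exact h1

/-- A planar neighbourhood would carry a half-disc at the boundary point onto a neighbourhood of a
point of ℂ; the inverse chart over a small circle is then the forbidden section. -/
theorem Topology.IsOpenEmbedding.isEmpty_homeomorph_plane {X : Type*} [TopologicalSpace X]
    {j : ℝ × ℝ≥0 → X} (hj : IsOpenEmbedding j) (s : ℝ) {U : Set X} (hU : U ∈ 𝓝 (j (s, 0))) :
    IsEmpty (U ≃ₜ ℝ × ℝ) := by
  refine ⟨fun e₀ => ?_⟩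
  let e : U ≃ₜ ℂ := e₀.trans Complex.equivRealProdCLM.symm.toHomeomorph
  -- The half-plane is seen in ℂ as Re z ≥ 0, the given point being 0. `m` collapses Re z < 0 onto
  -- the edge, so `m'` inverts it only where Re z ≥ 0.
  let m : ℂ → ℝ × ℝ≥0 := fun z => (s + z.im, z.re.toNNReal)
  let m' : ℝ × ℝ≥0 → ℂ := fun x => x.2 + (x.1 - s : ℝ) * Complex.I
  have hmc : Continuous m := by fun_prop
  have hmc' : Continuous m' := by fun_prop
  have hmm' : ∀ x, m (m' x) = x := fun x => by simp [m, m']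
  have hm'm : ∀ z : ℂ, 0 ≤ z.re → m' (m z) = z := fun z hz => by
    simp [m, m', Real.coe_toNNReal _ hz, Complex.re_add_im]
  have hm0 : m 0 = (s, 0) := by simp [m]
  have hm're : ∀ x, 0 ≤ (m' x).re := fun x => by simp [m']
  obtain ⟨r, hr, hrU⟩ : ∃ r > 0, ∀ z : ℂ, ‖z‖ < r → j (m z) ∈ U := by
    have : ∀ᶠ z in 𝓝 (0 : ℂ), j (m z) ∈ U :=
      (hj.continuous.comp hmc).continuousAt (by simpa [hm0] using hU)
    simpa using Metric.eventually_nhds_iff.1 this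
  classical
  let f : ℂ → ℂ := fun z => if h : j (m z) ∈ U then e ⟨_, h⟩ else 0
  have hf : ∀ z (h : j (m z) ∈ U), f z = e ⟨_, h⟩ := fun z h => dif_pos h
  have hfc : ContinuousOn f {z | ‖z‖ < r} := by
    rw [continuousOn_iff_continuous_domRestrict]
    have : Continuous fun z : {z : ℂ | ‖z‖ < r} => e ⟨j (m z), hrU z z.2⟩ :=
      e.continuous.comp ((hj.continuous.comp (hmc.comp continuous_subtype_val)).subtype_mk _)
    convert this using 1
    exact funext fun z => hf _ _
  have h0U : j (m 0) ∈ U := hrU 0 (by simpa using hr)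
  let W : Set X := j '' {x | ‖m' x‖ < r}
  have hW : IsOpen W := hj.isOpenMap _ (isOpen_lt hmc'.norm continuous_const)
  have h0W : j (m 0) ∈ W := ⟨m 0, by simpa [hm'm] using hr, rfl⟩
  have hWev : ∀ᶠ q in 𝓝 (e ⟨_, h0U⟩), (e.symm q : X) ∈ W :=
    (continuous_subtype_val.comp e.symm.continuous).continuousAt
      (hW.mem_nhds (by simpa using h0W))
  obtain ⟨ε, hε, hεW⟩ := Metric.nhds_basis_closedBall.eventually_iff.1 hWev
  let g₀ := hj.toOpenPartialHomeomorph j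
  refine Complex.not_exists_halfDisc_section (f := f) (g := fun q => m' (g₀.symm (e.symm q)))
    (p := e ⟨_, h0U⟩) hr hε (hfc.mono fun z hz => hz.1) (hf _ _) ?_ ?_ ?_
  · intro z hz hre hz0 h
    rw [hf z (hrU z hz)] at h
    have h1 := hj.injective (congrArg Subtype.val (e.injective h))
    refine hz0 ?_
    rw [← hm'm z hre, h1, hm'm 0 le_rfl]
  · refine hmc'.comp_continuousOn (g₀.symm.continuousOn.comp
      (continuous_subtype_val.comp e.symm.continuous).continuousOn fun q hq => ?_)
    obtain ⟨x, -, hx⟩ := hεW (Metric.sphere_subset_closedBall hq)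
    simpa [g₀] using ⟨_, _, hx⟩
  · intro q hq
    obtain ⟨x, hx, hxq⟩ := hεW (Metric.sphere_subset_closedBall hq)
    have h1 : g₀.symm (e.symm q) = x := by
      rw [← hxq]
      exact g₀.left_inv (by simp [g₀])
    simp only [h1]
    refine ⟨hx, hm're x, ?_⟩
    have h2 : j (m (m' x)) = e.symm q := by rw [hmm', hxq]
    rw [hf _ (h2 ▸ (e.symm q).2)]
    rw [← e.eq_symm_apply]
    exact Subtype.ext h2

/-! ### The Nyikosisation as a surface -/

theorem nonempty_homeomorph_real_Ioo : Nonempty (ℝ ≃ₜ Ioo (0 : I) 1) := by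
  let f : Ioo (0 : I) 1 → Ioo (-1 : ℝ) 1 := fun s =>
    ⟨2 * (s : I) - 1, by linarith [Subtype.coe_lt_coe.2 s.2.1, show ((0 : I) : ℝ) = 0 from rfl],
      by linarith [Subtype.coe_lt_coe.2 s.2.2, show ((1 : I) : ℝ) = 1 from rfl]⟩
  have hf : StrictMono f := fun s s' h => by
    have h' : ((s : I) : ℝ) < (s' : I) := h
    exact Subtype.mk_lt_mk.2 (by linarith)
  have hs : Function.Surjective f := fun t => by
    obtain ⟨t, h1, h2⟩ := t
    refine ⟨⟨⟨(t + 1) / 2, by linarith, by linarith⟩, ?_, ?_⟩, Subtype.ext ?_⟩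
    · exact Subtype.coe_lt_coe.1 (by simpa using by linarith)
    · exact Subtype.coe_lt_coe.1 (show (t + 1) / 2 < 1 by linarith)
    · simp only [f]
      ring
  exact ⟨((orderIsoIooNegOneOne ℝ).trans (hf.orderIsoOfSurjective f hs).symm).toHomeomorph⟩

theorem exists_homeomorph_nnreal_Ico {w : ℝ} (hw : 0 < w) :
    ∃ φ : ℝ≥0 ≃ₜ Ico (0 : ℝ) w, φ 0 = ⟨0, le_rfl, hw⟩ := by
  let f : Ico (0 : ℝ) w → ℝ≥0 := fun t => ⟨t / (w - t), div_nonneg t.2.1 (sub_pos.2 t.2.2).le⟩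
  have hf : StrictMono f := fun t t' h => by
    have h' : (t : ℝ) < t' := h
    refine Subtype.mk_lt_mk.2 ?_
    rw [div_lt_div_iff₀ (sub_pos.2 t.2.2) (sub_pos.2 t'.2.2)]
    nlinarith
  have hs : Function.Surjective f := fun r => by
    have hr : (0 : ℝ) < 1 + r := by positivity
    refine ⟨⟨w * r / (1 + r), by positivity, ?_⟩, Subtype.ext ?_⟩
    · rw [div_lt_iff₀ hr]
      nlinarith
    · simp only [f]
      have : w - w * r / (1 + r) = w / (1 + r) := by field_simp; ring
      rw [this]
      field_simp
      rfl
  refine ⟨(hf.orderIsoOfSurjective f hs).symm.toHomeomorph, ?_⟩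
  refine (hf.orderIsoOfSurjective f hs).symm_apply_eq.2 (Subtype.ext ?_)
  exact (zero_div (w - 0)).symm

namespace Nyikosisation

variable {a : ℝ} {c : CurveFamily LongRay a}

theorem exists_chart (x : LongRay) :
    ∃ j : ℝ × ℝ≥0 → Nyikosisation c, IsOpenEmbedding j ∧ ∃ s, j (s, 0) = ray x := by
  obtain ⟨w, hw, J, hJ, s, hs⟩ := exists_chart_on_box (c := c) x
  obtain ⟨ψ⟩ := nonempty_homeomorph_real_Ioo
  obtain ⟨φ, hφ⟩ := exists_homeomorph_nnreal_Ico hw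
  refine ⟨J ∘ ψ.prodCongr φ, hJ.comp (ψ.prodCongr φ).isOpenEmbedding, ψ.symm s, ?_⟩
  simp [hφ, hs]

theorem isSurface : IsSurface (Nyikosisation c) := by
  refine ⟨t2Space, ?_⟩
  rintro (p | x)
  · have hp : 0 < p.1.1 / 2 := half_pos p.2
    -- Neighbourhoods need not be open: the closed half-plane starting at half the abscissa of p
    -- contains p in its interior.
    let i : ℝ × ℝ≥0 → OpenHalfPlane := fun q => ⟨(p.1.1 / 2 + q.2, q.1), by positivity⟩
    have hi : IsEmbedding i := by
      refine Function.LeftInverse.isEmbedding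
        (f := fun q : OpenHalfPlane => (q.1.2, (q.1.1 - p.1.1 / 2).toNNReal)) (fun q => ?_)
        (by fun_prop) (by fun_prop)
      simp [i]
    refine ⟨range (plane ∘ i), ?_,
      ⟨(isOpenEmbedding_plane.isEmbedding.comp hi).toHomeomorph.symm⟩⟩
    rw [range_comp]
    refine isOpenEmbedding_plane.isOpenMap.image_mem_nhds ?_
    have ho : IsOpen {q : OpenHalfPlane | p.1.1 / 2 < q.1.1} :=
      isOpen_lt continuous_const (by fun_prop)
    refine mem_of_superset (ho.mem_nhds (half_lt_self p.2)) fun q hq => ?_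
    have hq' : p.1.1 / 2 < q.1.1 := hq
    refine ⟨(q.1.2, (q.1.1 - p.1.1 / 2).toNNReal), Subtype.ext (Prod.ext ?_ rfl)⟩
    simp [i, Real.coe_toNNReal _ (sub_pos.2 hq').le]
  · obtain ⟨j, hj, s, hs⟩ := exists_chart (c := c) x
    exact ⟨range j, hs ▸ hj.isOpen_range.mem_nhds (mem_range_self _),
      ⟨hj.isEmbedding.toHomeomorph.symm⟩⟩

theorem _root_.nonempty_homeomorph_openHalfPlane : Nonempty (OpenHalfPlane ≃ₜ ℝ × ℝ) :=
  ⟨{ toFun := fun p => (Real.log p.1.1, p.1.2)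
     invFun := fun q => ⟨(Real.exp q.1, q.2), Real.exp_pos _⟩
     left_inv := fun p => Subtype.ext (Prod.ext (Real.exp_log p.2) rfl)
     right_inv := fun q => by simp
     continuous_toFun :=
      ((continuous_fst.comp continuous_subtype_val).log fun p => p.2.ne').prodMk (by fun_prop)
     continuous_invFun := by fun_prop }⟩

theorem surfaceBoundary_eq : surfaceBoundary (Nyikosisation c) = range ray := by
  ext X
  rcases X with p | x
  · obtain ⟨e⟩ := nonempty_homeomorph_openHalfPlane
    simp only [surfaceBoundary, mem_ofPred_eq, mem_range, reduceCtorEq, exists_false, iff_false,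
      not_not]
    exact ⟨range plane, isOpenEmbedding_plane.isOpen_range.mem_nhds (mem_range_self _),
      ⟨isOpenEmbedding_plane.isEmbedding.toHomeomorph.symm.trans e⟩⟩
  · refine iff_of_true ?_ (mem_range_self x)
    rintro ⟨U, hU, ⟨e⟩⟩
    obtain ⟨j, hj, s, hs⟩ := exists_chart (c := c) x
    exact (hj.isEmpty_homeomorph_plane s (hs ▸ hU)).false e

theorem not_isCollared : ¬ IsCollared (range (ray : LongRay → Nyikosisation c)) := by
  rintro ⟨h, hemb, -, hpre, -⟩
  let r : LongRay → range (ray : LongRay → Nyikosisation c) := fun x => ⟨ray x, mem_range_self x⟩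
  let φ : LongRay → Nyikosisation c := fun x => h (r x, 1)
  have hr : IsEmbedding r := isEmbedding_ray.toHomeomorph.isEmbedding
  have hφ : IsEmbedding φ :=
    hemb.comp ((isEmbedding_prodMkLeft (1 : I)).comp hr)
  -- The slice at height 1 avoids the added ray, whose preimage under the collar is the slice at
  -- height 0.
  have hmem : ∀ x, ∃ p, plane p = φ x := fun x => by
    rw [← mem_range, range_plane_eq]
    intro hx
    have : (r x, (1 : I)) ∈ h ⁻¹' range ray := hx
    rw [hpre] at this
    exact one_ne_zero (α := I) this
  choose ψ hψ using hmem
  have hψe : IsEmbedding ψ := by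
    rw [← (isOpenEmbedding_plane (c := c)).isEmbedding.of_comp_iff]
    convert hφ using 1
    exact funext hψ
  have := hψe.secondCountableTopology
  exact LongRay.not_separableSpace inferInstance

end Nyikosisation

theorem mainTheorem9 (a : ℝ) :
    Nonempty (CurveFamily OmegaOne a) ∧
    (∀ d : CurveFamily OmegaOne a, ∃ c : CurveFamily LongRay a,
      ∀ (α : OmegaOne) (hα : ¬ IsMin (ClosedLongRay.ofOmegaOne α)),
        EqOn (c.curve ⟨ClosedLongRay.ofOmegaOne α, hα⟩) (d.curve α) (Ioi 0)) ∧
    ∀ c : CurveFamily LongRay a,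
      IsSurface (Nyikosisation c) ∧
      TopologicalSpace.MetrizableSpace ↥(surfaceBoundary (Nyikosisation c))ᶜ ∧
      surfaceBoundary (Nyikosisation c) = range Nyikosisation.ray ∧
      IsConnected (surfaceBoundary (Nyikosisation c)) ∧
      IsEmbedding (Nyikosisation.ray : LongRay → Nyikosisation c) ∧
      ¬ IsCollared (surfaceBoundary (Nyikosisation c)) := by
  refine ⟨nonempty_curveFamily_omegaOne a, exists_curveFamily_longRay, fun c => ?_⟩
  rw [Nyikosisation.surfaceBoundary_eq]
  refine ⟨Nyikosisation.isSurface, ?_, rfl, ⟨range_nonempty _, ?_⟩,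
    Nyikosisation.isEmbedding_ray, Nyikosisation.not_isCollared⟩
  · rw [← Nyikosisation.range_plane_eq]
    exact Nyikosisation.isOpenEmbedding_plane.isEmbedding.toHomeomorph.symm.isEmbedding.metrizableSpace
  · rw [← image_univ]
    exact LongRay.isPreconnected_univ.image _ Nyikosisation.isEmbedding_ray.continuous.continuousOn
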